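/- **Setting.** Let $d\in\mathbb N$, $\mathbb T^d=(\mathbb R/\mathbb Z)^d$ and $\hat\varphi(k)=\int_{\mathbb T^d}\varphi(x)e^{-2\pi i k\cdot x}\,dx$. Let $\mathcal S(\mathbb T^d)$ be the space of smooth $\varphi:\mathbb T^d\to\mathbb C$ with $p_N(\varphi)=\sup_{k\in\mathbb Z^d}(1+|k|^2)^N|\hat\varphi(k)|<\infty$ for all $N\in\mathbb N$, with the topology given by the seminorms $p_N$; distributions are continuous linear functionals on it. A real generalized random field (GeRF) on $\mathbb T^d$ is a continuous linear map $Z:\mathcal S(\mathbb T^d)\to L^2(\Omega,\mathcal F,\mathbb P;\mathbb C)$, for a probability space $(\Omega,\mathcal F,\mathbb P)$, with $\langle Z,\bar\varphi\rangle=\overline{\langle Z,\varphi\rangle}$ a.s.; all GeRFs are assumed to have mean zero. It is stationary if there is a distribution $\rho_Z$ with $\mathrm{Cov}(\langle Z,\varphi\rangle,\langle Z,\psi\rangle)=\langle\rho_Z,\varphi*\check{\bar\psi}\rangle$ for all $\varphi,\psi\in\mathcal S(\mathbb T^d)$, where $\check f(x)=f(-x)$. Let $\mathcal M^+_{SG}(\mathbb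 Z^d)$ be the set of positive measures $\mu$ on $\mathbb Z^d$ such that $\sum_k(1+|k|^2)^{-N}\mu(\{k\})<\infty$ for some $N\in\mathbb N$. The spectral measure of $Z$ is the measure $\mu_Z\in\mathcal M^+_{SG}(\mathbb Z^d)$ with $\rho_Z=\mathcal F^{-1}\mu_Z=\sum_k\mu_Z(\{k\})e^{2\pi i k\cdot x}$. A symbol is a polynomially bounded $g:\mathbb Z^d\to\mathbb C$ with $g(-k)=\overline{g(k)}$; $\mathcal L_g$ multiplies the $k$-th Fourier coefficient by $g(k)$, and on GeRFs it is defined by duality. Two GeRFs, possibly on different probability spaces, are equal in the second-order sense, $Z\stackrel{2nd\,o.}{=}W$, if they have the same mean and the same covariance. **Theorem (Existence and Uniqueness).** Let $X$ be a real stationary GeRF on $\mathbb T^d$ with spectral measure $\mu_X$, and let $g$ be a symbol. Then: (i) There exists a real stationary GeRF $U$ with $\mathcal L_gU\stackrel{2nd\,o.}{=}X$ if and only if there exists $N\in\mathbb N$ such that $$\sum_{k\in\mathbb Z^d}\frac{\mu_X(\{k\})}{|g(k)|^2(1+|k|^2)^N}<\infty ,$$ where a term with $g(k)=0$ is $0$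 if $\mu_X(\{k\})=0$ and $+\infty$ if $\mu_X(\{k\})>0$. This holds both when $U$ is required to live on the probability space of $X$ and when $U$ may live on any probability space. (ii) In that case the measure given by $\mu_U(\{k\})=\mu_X(\{k\})/|g(k)|^2$ (with $\mu_U(\{k\})=0$ when $g(k)=0$) belongs to $\mathcal M^+_{SG}(\mathbb Z^d)$, is even, and is the spectral measure of some real stationary GeRF; and every real stationary GeRF (on any probability space) with spectral measure $\mu_U$ solves $\mathcal L_gU\stackrel{2nd\,o.}{=}X$. (iii) In that case there is exactly one measure in $\mathcal M^+_{SG}(\mathbb Z^d)$ which is the spectral measure of a real stationary solution $U$ (on any probability space) of $\mathcal L_gU\stackrel{2nd\,o.}{=}X$ if and only if $|g(k)|>0$ for all $k\in\mathbb Z^d$. -/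

import Mathlib

open MeasureTheory UnitAddTorus
open scoped ENNReal ComplexConjugate

universe u v

noncomputable section

namespace TorusField

/-! ### The torus, frequencies and Fourier coefficients

The torus is `UnitAddTorus (Fin d) = (ℝ/ℤ)^d`, the characters are
`mFourier k x = exp (2 π i k · x)`, and `mFourierCoeff u k = ∫ u(x) exp (-2 π i k · x) dx`. -/

/-- The weight `1 + |k|²`, with `|k|` the Euclidean norm of `k ∈ ℤ^d`. -/
def weight {d : ℕ} (k : Fin d → ℤ) : ℝ := 1 + ∑ i, (k i : ℝ) ^ 2

/-- The probability Haar measure on the torus. -/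
def haar (d : ℕ) : Measure (UnitAddTorus (Fin d)) :=
  Measure.pi fun _ => AddCircle.haarAddCircle

/-- The `ℤ^d`-periodic function on `ℝ^d` given by a function on the torus. -/
def periodicLift {d : ℕ} (u : UnitAddTorus (Fin d) → ℂ) : (Fin d → ℝ) → ℂ :=
  fun x => u fun i => (x i : UnitAddCircle)

/-- Rapid decrease of a family of coefficients. -/
def RapidDecay {d : ℕ} (c : (Fin d → ℤ) → ℂ) : Prop :=
  ∀ N : ℕ, BddAbove (Set.range fun k => weight k ^ N * ‖c k‖)

lemma one_le_weight {d : ℕ} (k : Fin d → ℤ) : 1 ≤ weight k := by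
  have : 0 ≤ ∑ i, (k i : ℝ) ^ 2 := Finset.sum_nonneg fun i _ => sq_nonneg _
  unfold weight
  linarith

lemma weight_pos {d : ℕ} (k : Fin d → ℤ) : 0 < weight k :=
  lt_of_lt_of_le one_pos (one_le_weight k)

lemma weight_neg {d : ℕ} (k : Fin d → ℤ) : weight (-k) = weight k := by
  simp [weight]

/-- The Fourier coefficient as a continuous linear functional on continuous functions. -/
def coeffCLM {d : ℕ} (k : Fin d → ℤ) : C(UnitAddTorus (Fin d), ℂ) →L[ℂ] ℂ :=
  LinearMap.mkContinuous
    { toFun := fun u => ∫ t, mFourier (-k) t * u t ∂(haar d)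
      map_add' := by
        intro u w
        have : IsProbabilityMeasure (haar d) := by unfold haar; infer_instance
        have h : ∀ w : C(UnitAddTorus (Fin d), ℂ),
            Integrable (fun t => mFourier (-k) t * w t) (haar d) := fun w =>
          Continuous.integrable_of_hasCompactSupport (by fun_prop)
            (HasCompactSupport.of_compactSpace _)
        simp only [ContinuousMap.add_apply, mul_add]
        exact integral_add (h u) (h w)
      map_smul' := by
        intro c u
        simp only [ContinuousMap.smul_apply, smul_eq_mul, RingHom.id_apply]
        rw [← integral_const_mul]
        congr 1
        ext t
        ring } 1 (by
    intro u
    have : IsProbabilityMeasure (haar d) := by unfold haar; infer_instance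
    refine (norm_integral_le_of_norm_le_const (C := 1 * ‖u‖) (Filter.Eventually.of_forall
      fun t => ?_)).trans (by simp)
    rw [norm_mul]
    gcongr
    · exact ((mFourier (-k)).norm_coe_le_norm t).trans mFourier_norm.le
    · exact u.norm_coe_le_norm t)

lemma coeffCLM_apply {d : ℕ} (k : Fin d → ℤ) (u : C(UnitAddTorus (Fin d), ℂ)) :
    coeffCLM k u = mFourierCoeff u k := rfl

lemma coeff_mFourier {d : ℕ} (m k : Fin d → ℤ) :
    mFourierCoeff (mFourier m : C(UnitAddTorus (Fin d), ℂ)) k = if k = m then 1 else 0 := by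
  rw [← mFourierCoeff_toLp, ← mFourierBasis_repr, HilbertBasis.repr_apply_apply,
    coe_mFourierBasis]
  exact orthonormal_iff_ite.mp orthonormal_mFourier k m

/-! ### Test functions -/

/-- Smooth functions on the torus with rapidly decreasing Fourier coefficients, as a subspace
of the continuous functions. -/
def testSubmodule (d : ℕ) : Submodule ℂ C(UnitAddTorus (Fin d), ℂ) where
  carrier := {u | ContDiff ℝ (⊤ : ℕ∞) (periodicLift u) ∧ RapidDecay (mFourierCoeff u)}
  zero_mem' := by
    refine ⟨?_, fun N => ⟨0, ?_⟩⟩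
    · exact contDiff_const (c := (0 : ℂ))
    · rintro _ ⟨k, rfl⟩
      have : mFourierCoeff (0 : C(UnitAddTorus (Fin d), ℂ)) k = 0 := (coeffCLM k).map_zero
      simp only [this, norm_zero, mul_zero, le_refl]
  add_mem' := by
    rintro u w ⟨hu, hu'⟩ ⟨hw, hw'⟩
    refine ⟨hu.add hw, fun N => ?_⟩
    obtain ⟨A, hA⟩ := hu' N
    obtain ⟨B, hB⟩ := hw' N
    refine ⟨A + B, ?_⟩
    rintro _ ⟨k, rfl⟩
    have h : mFourierCoeff (u + w) k = mFourierCoeff u k + mFourierCoeff w k :=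
      (coeffCLM k).map_add u w
    have h1 := hA ⟨k, rfl⟩
    have h2 := hB ⟨k, rfl⟩
    have h3 := norm_add_le (mFourierCoeff u k) (mFourierCoeff w k)
    have h4 : 0 ≤ weight k ^ N := (pow_pos (weight_pos k) N).le
    simp only at h1 h2 ⊢
    rw [h]
    nlinarith
  smul_mem' := by
    rintro c u ⟨hu, hu'⟩
    refine ⟨hu.const_smul c, fun N => ?_⟩
    obtain ⟨A, hA⟩ := hu' N
    refine ⟨‖c‖ * A, ?_⟩
    rintro _ ⟨k, rfl⟩
    have h : mFourierCoeff (c • u) k = c * mFourierCoeff u k := (coeffCLM k).map_smul c u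
    have h1 := hA ⟨k, rfl⟩
    have h2 := norm_nonneg c
    simp only at h1 ⊢
    rw [h, norm_mul]
    nlinarith

/-- The space `𝒮(𝕋^d)` of (complex) test functions. -/
def TestFunction (d : ℕ) : Type := testSubmodule d

instance (d : ℕ) : AddCommGroup (TestFunction d) := inferInstanceAs (AddCommGroup (testSubmodule d))

instance (d : ℕ) : Module ℂ (TestFunction d) := inferInstanceAs (Module ℂ (testSubmodule d))

variable {d : ℕ}

/-- The underlying continuous function of a test function. -/
def TestFunction.toC (φ : TestFunction d) : C(UnitAddTorus (Fin d), ℂ) := φ.1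

instance : CoeFun (TestFunction d) fun _ => UnitAddTorus (Fin d) → ℂ := ⟨fun φ => φ.toC⟩

/-- The Fourier coefficient `∫ φ(x) exp (-2 π i k · x) dx`. -/
def TestFunction.coeff (φ : TestFunction d) (k : Fin d → ℤ) : ℂ := mFourierCoeff φ k

lemma TestFunction.coeff_eq_integral (φ : TestFunction d) (k : Fin d → ℤ) :
    φ.coeff k = ∫ x, mFourier (-k) x * φ x ∂(haar d) := rfl

lemma TestFunction.coeff_add (φ ψ : TestFunction d) (k : Fin d → ℤ) :
    (φ + ψ).coeff k = φ.coeff k + ψ.coeff k := (coeffCLM k).map_add φ.toC ψ.toC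

lemma TestFunction.coeff_smul (c : ℂ) (φ : TestFunction d) (k : Fin d → ℤ) :
    (c • φ).coeff k = c * φ.coeff k := (coeffCLM k).map_smul c φ.toC

lemma TestFunction.rapidDecay (φ : TestFunction d) : RapidDecay φ.coeff := φ.2.2

/-- The seminorm `sup_k (1 + |k|²)^N |φ̂(k)|`. -/
def testSeminorm (d N : ℕ) : Seminorm ℂ (TestFunction d) :=
  Seminorm.of (fun φ => ⨆ k, weight k ^ N * ‖φ.coeff k‖)
    (by
      intro φ ψ
      refine ciSup_le fun k => ?_
      have h1 := le_ciSup (φ.rapidDecay N) k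
      have h2 := le_ciSup (ψ.rapidDecay N) k
      have h3 := norm_add_le (φ.coeff k) (ψ.coeff k)
      have h4 : 0 ≤ weight k ^ N := (pow_pos (weight_pos k) N).le
      rw [TestFunction.coeff_add]
      nlinarith)
    (by
      intro c φ
      rw [Real.mul_iSup_of_nonneg (norm_nonneg c)]
      congr 1
      ext k
      rw [TestFunction.coeff_smul, norm_mul]
      ring)

/-- The Fréchet topology of the test function space, given by the seminorms
`sup_k (1 + |k|²)^N |φ̂(k)|`, `N ∈ ℕ`. -/
instance : TopologicalSpace (TestFunction d) :=
  SeminormFamily.moduleFilterBasis (testSeminorm d) |>.topology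

lemma withSeminorms (d : ℕ) : WithSeminorms (𝕜 := ℂ) (E := TestFunction d) (testSeminorm d) :=
  ⟨rfl⟩

lemma le_testSeminorm (φ : TestFunction d) (N : ℕ) (k : Fin d → ℤ) :
    weight k ^ N * ‖φ.coeff k‖ ≤ testSeminorm d N φ :=
  le_ciSup (φ.rapidDecay N) k

/-! ### Synthesis of test functions from rapidly decreasing coefficients -/

lemma summable_prod_fin {f : ℤ → ℝ} (h0 : ∀ n, 0 ≤ f n) (hf : Summable f) :
    ∀ d : ℕ, Summable fun k : Fin d → ℤ => ∏ i, f (k i)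
  | 0 => (hasSum_fintype _).summable
  | d + 1 => by
    rw [← (Fin.consEquiv fun _ : Fin (d + 1) => ℤ).summable_iff]
    have := hf.mul_of_nonneg (summable_prod_fin h0 hf d) h0
      (fun k => Finset.prod_nonneg fun i _ => h0 _)
    refine this.congr fun x => ?_
    simp [Fin.consEquiv, Fin.prod_univ_succ]

lemma summable_int_inv : Summable fun n : ℤ => (1 + (n : ℝ) ^ 2)⁻¹ := by
  have h := (Real.summable_one_div_int_pow (p := 2)).mpr one_lt_two
  refine Summable.of_norm_bounded_eventually h ?_
  rw [Filter.eventually_cofinite]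
  refine (Set.finite_singleton (0 : ℤ)).subset fun n hn => ?_
  by_contra hn0
  apply hn
  have : (0 : ℝ) < (n : ℝ) ^ 2 := by
    have : (n : ℝ) ≠ 0 := by exact_mod_cast hn0
    positivity
  rw [Real.norm_of_nonneg (by positivity), one_div]
  gcongr
  linarith

lemma summable_weight (d : ℕ) : Summable fun k : Fin d → ℤ => (weight k ^ d)⁻¹ := by
  refine Summable.of_nonneg_of_le (fun k => (inv_pos.2 (pow_pos (weight_pos k) d)).le)
    (fun k => ?_) (summable_prod_fin (fun n => by positivity) summable_int_inv d)
  rw [Finset.prod_inv_distrib]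
  refine inv_anti₀ (Finset.prod_pos fun i _ => by positivity) ?_
  calc ∏ i, (1 + (k i : ℝ) ^ 2) ≤ ∏ _i : Fin d, weight k := by
        refine Finset.prod_le_prod (fun i _ => by positivity) fun i _ => ?_
        have := Finset.single_le_sum (f := fun i => (k i : ℝ) ^ 2) (fun i _ => sq_nonneg _)
          (Finset.mem_univ i)
        simp only [weight]
        linarith
    _ = weight k ^ d := by simp

lemma RapidDecay.summable {c : (Fin d → ℤ) → ℂ} (hc : RapidDecay c) (N : ℕ) :
    Summable fun k => weight k ^ N * ‖c k‖ := by
  obtain ⟨A, hA⟩ := hc (N + d)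
  refine Summable.of_nonneg_of_le (fun k => mul_nonneg (pow_pos (weight_pos k) N).le
    (norm_nonneg _)) (fun k => ?_) ((summable_weight d).mul_left A)
  have h := hA ⟨k, rfl⟩
  have hp := pow_pos (weight_pos k) d
  rw [← div_eq_mul_inv, le_div_iff₀ hp]
  simp only [pow_add] at h
  linarith

lemma RapidDecay.summable_norm {c : (Fin d → ℤ) → ℂ} (hc : RapidDecay c) :
    Summable fun k => ‖c k‖ := by
  simpa using hc.summable 0

lemma RapidDecay.summable_series {c : (Fin d → ℤ) → ℂ} (hc : RapidDecay c) :
    Summable fun k => c k • (mFourier k : C(UnitAddTorus (Fin d), ℂ)) := by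
  refine Summable.of_norm (hc.summable_norm.congr fun k => ?_)
  rw [norm_smul, mFourier_norm, mul_one]

/-- The sum of a Fourier series with rapidly decreasing coefficients. -/
def series (c : (Fin d → ℤ) → ℂ) : C(UnitAddTorus (Fin d), ℂ) := ∑' k, c k • mFourier k

lemma coeff_series {c : (Fin d → ℤ) → ℂ} (hc : RapidDecay c) (n : Fin d → ℤ) :
    mFourierCoeff (series c) n = c n := by
  have h := (coeffCLM n).hasSum hc.summable_series.hasSum
  have h2 : HasSum (fun k => coeffCLM n (c k • mFourier k)) (c n) := by
    have : (fun k => coeffCLM n (c k • mFourier k)) = fun k => if k = n then c n else 0 := by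
      ext k
      rw [map_smul, coeffCLM_apply, coeff_mFourier, smul_eq_mul]
      by_cases hk : k = n
      · simp [hk]
      · simp [hk, Ne.symm hk]
    rw [this]
    exact hasSum_ite_eq n (c n)
  exact h.unique h2

/-- The linear form `x ↦ k · x`. -/
def dotCLM (k : Fin d → ℤ) : (Fin d → ℝ) →L[ℝ] ℝ :=
  ∑ i, (k i : ℝ) • ContinuousLinearMap.proj (R := ℝ) (φ := fun _ : Fin d => ℝ) i

lemma norm_dotCLM_le (k : Fin d → ℤ) : ‖dotCLM k‖ ≤ d * weight k := by
  refine (norm_sum_le _ _).trans ?_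
  calc ∑ i, ‖(k i : ℝ) • ContinuousLinearMap.proj (R := ℝ) (φ := fun _ : Fin d => ℝ) i‖
      ≤ ∑ _i : Fin d, weight k := by
        refine Finset.sum_le_sum fun i _ => ?_
        rw [norm_smul]
        have h1 : ‖ContinuousLinearMap.proj (R := ℝ) (φ := fun _ : Fin d => ℝ) i‖ ≤ 1 :=
          ContinuousLinearMap.opNorm_le_bound _ zero_le_one fun x => by
            simpa using norm_le_pi_norm x i
        have h2 := Finset.single_le_sum (f := fun i => (k i : ℝ) ^ 2) (fun i _ => sq_nonneg _)
          (Finset.mem_univ i)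
        have h3 : ‖(k i : ℝ)‖ ≤ weight k := by
          simp only [weight, Real.norm_eq_abs]
          nlinarith [sq_abs (k i : ℝ), sq_nonneg (|(k i : ℝ)| - 1)]
        calc _ ≤ ‖(k i : ℝ)‖ * 1 := by gcongr
          _ ≤ _ := by simpa using h3
    _ = d * weight k := by simp

lemma mFourier_lift (k : Fin d → ℤ) (x : Fin d → ℝ) :
    mFourier k (fun i => (x i : UnitAddCircle)) =
      Complex.exp (2 * Real.pi * Complex.I * (dotCLM k x : ℝ)) := by
  simp only [mFourier, ContinuousMap.coe_mk, fourier_coe_apply, dotCLM]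
  rw [← Complex.exp_sum]
  congr 1
  simp only [sum_apply, smul_apply,
    ContinuousLinearMap.proj_apply, smul_eq_mul, Complex.ofReal_sum, Finset.mul_sum]
  refine Finset.sum_congr rfl fun i _ => ?_
  push_cast
  ring

lemma norm_iteratedFDeriv_exp (n : ℕ) (t : ℝ) :
    ‖iteratedFDeriv ℝ n (fun t : ℝ => Complex.exp (2 * Real.pi * Complex.I * t)) t‖
      ≤ (2 * Real.pi) ^ n := by
  rw [norm_iteratedFDeriv_eq_norm_iteratedDeriv]
  have : ∀ n : ℕ, iteratedDeriv n (fun t : ℝ => Complex.exp (2 * Real.pi * Complex.I * t)) =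
      fun t : ℝ => (2 * Real.pi * Complex.I) ^ n * Complex.exp (2 * Real.pi * Complex.I * t) := by
    intro n
    induction n with
    | zero => simp
    | succ n ih =>
      rw [iteratedDeriv_succ, ih]
      ext t
      have h1 : HasDerivAt (fun t : ℝ => 2 * Real.pi * Complex.I * (t : ℂ))
          (2 * Real.pi * Complex.I * 1) t :=
        (Complex.ofRealCLM.hasDerivAt (x := t)).const_mul _
      rw [(h1.cexp.const_mul _).deriv]
      ring
  rw [this]
  have h2 : 2 * Real.pi * Complex.I * (t : ℂ) = ((2 * Real.pi * t : ℝ) : ℂ) * Complex.I := by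
    push_cast
    ring
  rw [norm_mul, h2, Complex.norm_exp_ofReal_mul_I, norm_pow]
  simp [abs_of_pos Real.pi_pos]

lemma contDiff_series {c : (Fin d → ℤ) → ℂ} (hc : RapidDecay c) :
    ContDiff ℝ (⊤ : ℕ∞) (periodicLift (series c)) := by
  have hE : ContDiff ℝ (⊤ : ℕ∞)
      (fun t : ℝ => Complex.exp (2 * Real.pi * Complex.I * t)) := by
    have h := (contDiff_const (c := 2 * Real.pi * Complex.I)).mul
      (Complex.ofRealCLM.contDiff (n := (⊤ : ℕ∞)))
    exact h.cexp
  have hterm : ∀ k : Fin d → ℤ, ContDiff ℝ (⊤ : ℕ∞)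
      ((fun t : ℝ => Complex.exp (2 * Real.pi * Complex.I * t)) ∘ dotCLM k) :=
    fun k => hE.comp (dotCLM k).contDiff
  have heq : periodicLift (series c) = fun x => ∑' k, c k •
      ((fun t : ℝ => Complex.exp (2 * Real.pi * Complex.I * t)) ∘ dotCLM k) x := by
    ext x
    have h := (ContinuousMap.evalCLM ℂ fun i => (x i : UnitAddCircle)).hasSum
      hc.summable_series.hasSum
    refine h.tsum_eq.symm.trans (tsum_congr fun k => ?_)
    simp only [map_smul, Function.comp_apply]
    rw [← mFourier_lift]
    rfl
  rw [heq]
  refine contDiff_tsum (v := fun n k => (2 * Real.pi) ^ n * (d : ℝ) ^ n * (weight k ^ n * ‖c k‖))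
    (fun k => (hterm k).const_smul (c k)) (fun n _ => (hc.summable n).mul_left _) ?_
  intro n k x _
  have hsm := iteratedFDeriv_const_smul_apply (𝕜 := ℝ) (i := n) (a := c k) (x := x)
    (((hterm k).of_le (by exact_mod_cast le_top)).contDiffAt)
  have hrw : (fun x => c k • ((fun t : ℝ => Complex.exp (2 * Real.pi * Complex.I * t)) ∘
      dotCLM k) x) = c k • ((fun t : ℝ => Complex.exp (2 * Real.pi * Complex.I * t)) ∘
      dotCLM k) := rfl
  rw [hrw, hsm, norm_smul, ContinuousLinearMap.iteratedFDeriv_comp_right (dotCLM k) hE x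
    (by exact_mod_cast le_top)]
  have h1 := ContinuousMultilinearMap.norm_compContinuousLinearMap_le
    (iteratedFDeriv ℝ n (fun t : ℝ => Complex.exp (2 * Real.pi * Complex.I * t)) (dotCLM k x))
    (fun _ => dotCLM k)
  have h2 : ∏ _i : Fin n, ‖dotCLM k‖ ≤ ((d : ℝ) * weight k) ^ n := by
    simp only [Finset.prod_const, Finset.card_univ, Fintype.card_fin]
    gcongr
    exact norm_dotCLM_le k
  have h3 := norm_iteratedFDeriv_exp n (dotCLM k x)
  calc _ ≤ ‖c k‖ * ((2 * Real.pi) ^ n * ((d : ℝ) * weight k) ^ n) := by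
        refine mul_le_mul_of_nonneg_left (h1.trans ?_) (norm_nonneg _)
        exact mul_le_mul h3 h2 (Finset.prod_nonneg fun _ _ => norm_nonneg _) (by positivity)
    _ = _ := by
      rw [mul_pow]
      ring

lemma series_mem {c : (Fin d → ℤ) → ℂ} (hc : RapidDecay c) : series c ∈ testSubmodule d :=
  ⟨contDiff_series hc, by
    have : mFourierCoeff (series c) = c := funext (coeff_series hc)
    rw [this]
    exact hc⟩

/-- The test function with prescribed (rapidly decreasing) Fourier coefficients. -/
def TestFunction.ofCoeff (c : (Fin d → ℤ) → ℂ) (hc : RapidDecay c) : TestFunction d :=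
  ⟨series c, series_mem hc⟩

lemma TestFunction.coeff_ofCoeff (c : (Fin d → ℤ) → ℂ) (hc : RapidDecay c) (k : Fin d → ℤ) :
    (TestFunction.ofCoeff c hc).coeff k = c k := coeff_series hc k

lemma TestFunction.toC_injective : Function.Injective (TestFunction.toC (d := d)) :=
  fun _ _ h => Subtype.ext h

lemma TestFunction.hasSum (φ : TestFunction d) :
    HasSum (fun k => φ.coeff k • mFourier k) φ.toC :=
  hasSum_mFourier_series_of_summable φ.rapidDecay.summable_norm.of_norm

lemma TestFunction.ext_coeff {φ ψ : TestFunction d} (h : ∀ k, φ.coeff k = ψ.coeff k) : φ = ψ := by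
  apply TestFunction.toC_injective
  have h1 := φ.hasSum
  simp only [h] at h1
  exact h1.unique ψ.hasSum

lemma rapidDecay_single (m : Fin d → ℤ) (a : ℂ) :
    RapidDecay fun k => if k = m then a else 0 := by
  refine fun N => ⟨weight m ^ N * ‖a‖, ?_⟩
  rintro _ ⟨k, rfl⟩
  by_cases hk : k = m
  · simp [hk]
  · simp only [hk, if_false, norm_zero, mul_zero]
    exact mul_nonneg (pow_pos (weight_pos m) N).le (norm_nonneg _)

/-- The character `x ↦ exp (2 π i m · x)` as a test function. -/
def character (m : Fin d → ℤ) : TestFunction d :=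
  ⟨mFourier m, by
    have h : mFourierCoeff (mFourier m : C(UnitAddTorus (Fin d), ℂ)) =
        fun k => if k = m then 1 else 0 := funext (coeff_mFourier m)
    have hs : series (fun k => if k = m then (1 : ℂ) else 0) = mFourier m := by
      unfold series
      rw [tsum_eq_single m]
      · simp
      · intro k hk
        simp only [if_neg hk]
        ext x
        exact zero_mul (mFourier k x)
    rw [← hs]
    exact series_mem (rapidDecay_single m 1)⟩

lemma coeff_character (m k : Fin d → ℤ) : (character m).coeff k = if k = m then 1 else 0 :=
  coeff_mFourier m k

/-- The complex conjugate of a test function. -/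
def TestFunction.conj (φ : TestFunction d) : TestFunction d :=
  ⟨star φ.toC, by
    refine ⟨?_, fun N => ?_⟩
    · exact (Complex.conjCLE.contDiff (n := (⊤ : ℕ∞))).comp φ.2.1
    · obtain ⟨A, hA⟩ := φ.rapidDecay N
      refine ⟨A, ?_⟩
      rintro _ ⟨k, rfl⟩
      have h : mFourierCoeff (star φ.toC) k = star (φ.coeff (-k)) := by
        rw [TestFunction.coeff_eq_integral]
        change ∫ t, mFourier (-k) t * star (φ.toC t) ∂(haar d) = _
        simp only [Complex.star_def]
        rw [← integral_conj]
        congr 1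
        ext t
        rw [map_mul, mFourier_neg, neg_neg]
      have h2 := hA ⟨-k, rfl⟩
      simp only [weight_neg] at h2
      simpa [h] using h2⟩

lemma TestFunction.conj_apply (φ : TestFunction d) (x : UnitAddTorus (Fin d)) :
    φ.conj x = (starRingEnd ℂ) (φ x) := rfl

lemma RapidDecay.mul_bounded {c e : (Fin d → ℤ) → ℂ} (hc : RapidDecay c) {A : ℝ} {M : ℕ}
    (he : ∀ k, ‖e k‖ ≤ A * weight k ^ M) : RapidDecay fun k => e k * c k := by
  intro N
  obtain ⟨B, hB⟩ := hc (N + M)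
  have hA : 0 ≤ A := by
    have h := (norm_nonneg _).trans (he 0)
    exact nonneg_of_mul_nonneg_left h (pow_pos (weight_pos _) _)
  refine ⟨A * B, ?_⟩
  rintro _ ⟨k, rfl⟩
  have h := hB ⟨k, rfl⟩
  simp only [pow_add] at h
  have hp := pow_pos (weight_pos k) N
  calc weight k ^ N * ‖e k * c k‖ = weight k ^ N * (‖e k‖ * ‖c k‖) := by rw [norm_mul]
    _ ≤ weight k ^ N * (A * weight k ^ M * ‖c k‖) := by
        gcongr
        exact he k
    _ = A * (weight k ^ N * weight k ^ M * ‖c k‖) := by ring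
    _ ≤ A * B := mul_le_mul_of_nonneg_left h hA

/-! ### The correlation `φ ∗ ψ̌̄` -/

/-- The function `(φ ∗ g)(x) = ∫ φ(y) g(x - y) dy` with `g(z) = conj (ψ(-z))`. -/
def corrFun (φ ψ : TestFunction d) (x : UnitAddTorus (Fin d)) : ℂ :=
  ∫ y, φ y * (starRingEnd ℂ) (ψ (-(x - y))) ∂(haar d)

lemma rapidDecay_corr (φ ψ : TestFunction d) :
    RapidDecay fun k => star (ψ.coeff k) * φ.coeff k := by
  obtain ⟨A, hA⟩ := ψ.rapidDecay 0
  refine φ.rapidDecay.mul_bounded (A := A) (M := 0) fun k => ?_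
  have := hA ⟨k, rfl⟩
  simpa using this

lemma corrFun_eq (φ ψ : TestFunction d) :
    corrFun φ ψ = series fun k => star (ψ.coeff k) * φ.coeff k := by
  have : IsProbabilityMeasure (haar d) := by unfold haar; infer_instance
  ext x
  have hS := (ContinuousMap.evalCLM ℂ x).hasSum (rapidDecay_corr φ ψ).summable_series.hasSum
  refine HasSum.unique ?_ hS
  have hpt : ∀ y, HasSum (fun k => φ y * (star (ψ.coeff k) * (mFourier k x * mFourier (-k) y)))
      (φ y * (starRingEnd ℂ) (ψ (-(x - y)))) := by
    intro y
    refine HasSum.mul_left _ ?_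
    have h := ((ContinuousMap.evalCLM ℂ (-(x - y))).hasSum ψ.hasSum).star
    refine (h.congr_fun fun k => ?_)
    have hmul : mFourier k (-(x - y)) = star (mFourier k x * mFourier (-k) y) := by
      rw [Complex.star_def, map_mul, mFourier_neg, Complex.conj_conj]
      simp only [mFourier, ContinuousMap.coe_mk, Pi.neg_apply, Pi.sub_apply, map_prod]
      rw [← Finset.prod_mul_distrib]
      refine Finset.prod_congr rfl fun i _ => ?_
      rw [neg_sub, sub_eq_neg_add, ← fourier_neg]
      simp only [fourier_apply, smul_add, smul_neg, neg_smul, AddCircle.toCircle_add,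
        Circle.coe_mul]
    change _ = star (ContinuousMap.evalCLM ℂ (-(x - y)) (ψ.coeff k • mFourier k))
    rw [map_smul]
    change _ = star (ψ.coeff k • mFourier k (-(x - y)))
    rw [hmul, star_smul, star_star, smul_eq_mul]
  have hb : ∀ k y, ‖φ y * (star (ψ.coeff k) * (mFourier k x * mFourier (-k) y))‖
      ≤ ‖φ.toC‖ * ‖ψ.coeff k‖ := by
    intro k y
    rw [norm_mul, norm_mul, norm_mul, norm_star]
    have h1 := (mFourier k).norm_coe_le_norm x
    have h2 := (mFourier (-k)).norm_coe_le_norm y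
    rw [mFourier_norm] at h1 h2
    have h3 := φ.toC.norm_coe_le_norm y
    have h4 : ‖mFourier k x‖ * ‖mFourier (-k) y‖ ≤ 1 := by
      nlinarith [norm_nonneg (mFourier k x), norm_nonneg (mFourier (-k) y)]
    calc _ ≤ ‖φ.toC‖ * (‖ψ.coeff k‖ * 1) := by gcongr
      _ = _ := by ring
  have hint := hasSum_integral_of_summable_integral_norm (μ := haar d)
    (F := fun k y => φ y * (star (ψ.coeff k) * (mFourier k x * mFourier (-k) y)))
    (fun k => Continuous.integrable_of_hasCompactSupport (by fun_prop)
      (HasCompactSupport.of_compactSpace _))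
    (by
      refine Summable.of_nonneg_of_le (fun k => integral_nonneg fun y => norm_nonneg _)
        (fun k => ?_) (ψ.rapidDecay.summable_norm.mul_left ‖φ.toC‖)
      have := norm_integral_le_of_norm_le_const (μ := haar d)
        (f := fun y => ‖φ y * (star (ψ.coeff k) * (mFourier k x * mFourier (-k) y))‖)
        (Filter.Eventually.of_forall fun y => by rw [norm_norm]; exact hb k y)
      exact (Real.le_norm_self _).trans (by simpa using this))
  have hL : ∫ y, ∑' k, φ y * (star (ψ.coeff k) * (mFourier k x * mFourier (-k) y)) ∂(haar d)
      = corrFun φ ψ x := by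
    unfold corrFun
    congr 1
    ext y
    exact (hpt y).tsum_eq
  rw [hL] at hint
  refine hint.congr_fun fun k => ?_
  rw [map_smul]
  change (star (ψ.coeff k) * φ.coeff k) * mFourier k x = _
  rw [TestFunction.coeff_eq_integral φ, mul_right_comm, ← integral_const_mul]
  congr 1
  ext y
  ring

/-- The convolution of `φ` with the reflected conjugate of `ψ`, as a test function:
`x ↦ ∫ φ(y) conj (ψ(-(x - y))) dy`. -/
def corr (φ ψ : TestFunction d) : TestFunction d :=
  ⟨⟨corrFun φ ψ, by rw [corrFun_eq]; exact ContinuousMap.continuous _⟩, by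
    have h : (⟨corrFun φ ψ, by rw [corrFun_eq]; exact ContinuousMap.continuous _⟩ :
        C(UnitAddTorus (Fin d), ℂ)) = series fun k => star (ψ.coeff k) * φ.coeff k := by
      ext x
      exact congrFun (corrFun_eq φ ψ) x
    rw [h]
    exact series_mem (rapidDecay_corr φ ψ)⟩

lemma coeff_corr (φ ψ : TestFunction d) (k : Fin d → ℤ) :
    (corr φ ψ).coeff k = φ.coeff k * star (ψ.coeff k) := by
  have h : corr φ ψ = TestFunction.ofCoeff _ (rapidDecay_corr φ ψ) := by
    apply TestFunction.toC_injective
    ext x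
    exact congrFun (corrFun_eq φ ψ) x
  rw [h, TestFunction.coeff_ofCoeff, mul_comm]

/-! ### Symbols and Fourier multipliers -/

/-- A symbol: a polynomially bounded `g : ℤ^d → ℂ` with `g(-k) = conj (g(k))`. -/
structure FourierSymbol (d : ℕ) where
  /-- The underlying function on frequencies. -/
  toFun : (Fin d → ℤ) → ℂ
  polyBounded : ∃ (C : ℝ) (N : ℕ), ∀ k, ‖toFun k‖ ≤ C * weight k ^ N
  hermitian : ∀ k, toFun (-k) = (starRingEnd ℂ) (toFun k)

instance : CoeFun (FourierSymbol d) fun _ => (Fin d → ℤ) → ℂ := ⟨FourierSymbol.toFun⟩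

lemma FourierSymbol.rapidDecay (g : FourierSymbol d) (φ : TestFunction d) :
    RapidDecay fun k => g (-k) * φ.coeff k := by
  obtain ⟨C, N, h⟩ := g.polyBounded
  refine φ.rapidDecay.mul_bounded (A := C) (M := N) fun k => ?_
  rw [← weight_neg k]
  exact h (-k)

/-- The transpose of the multiplier `g` on test functions: the multiplier `k ↦ g(-k)`. -/
def transposeMultiplier (g : FourierSymbol d) : TestFunction d →L[ℂ] TestFunction d where
  toFun φ := TestFunction.ofCoeff (fun k => g (-k) * φ.coeff k) (g.rapidDecay φ)
  map_add' φ ψ := TestFunction.ext_coeff fun k => by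
    simp only [TestFunction.coeff_add, TestFunction.coeff_ofCoeff, mul_add]
  map_smul' c φ := TestFunction.ext_coeff fun k => by
    simp only [TestFunction.coeff_smul, TestFunction.coeff_ofCoeff, RingHom.id_apply]
    ring
  cont := by
    obtain ⟨C, M, h⟩ := g.polyBounded
    have hC : 0 ≤ C := by
      have h := (norm_nonneg _).trans (h 0)
      exact nonneg_of_mul_nonneg_left h (pow_pos (weight_pos _) _)
    let L : TestFunction d →ₗ[ℂ] TestFunction d :=
      { toFun := fun φ => TestFunction.ofCoeff (fun k => g (-k) * φ.coeff k) (g.rapidDecay φ)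
        map_add' := fun φ ψ => TestFunction.ext_coeff fun k => by
          simp only [TestFunction.coeff_add, TestFunction.coeff_ofCoeff, mul_add]
        map_smul' := fun c φ => TestFunction.ext_coeff fun k => by
          simp only [TestFunction.coeff_smul, TestFunction.coeff_ofCoeff, RingHom.id_apply]
          ring }
    refine WithSeminorms.continuous_of_isBounded (withSeminorms d) (withSeminorms d) L fun N =>
      ⟨{N + M}, ⟨C, hC⟩, fun φ => ?_⟩
    refine ciSup_le fun k => ?_
    have h1 := le_testSeminorm φ (N + M) k
    have h2 := h (-k)
    rw [weight_neg] at h2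
    have hp := pow_pos (weight_pos k) N
    simp only [Finset.sup_singleton]
    change weight k ^ N * ‖(TestFunction.ofCoeff (fun k => g (-k) * φ.coeff k)
      (g.rapidDecay φ)).coeff k‖ ≤ C * testSeminorm d (N + M) φ
    rw [TestFunction.coeff_ofCoeff, norm_mul]
    calc weight k ^ N * (‖g (-k)‖ * ‖φ.coeff k‖)
        ≤ weight k ^ N * (C * weight k ^ M * ‖φ.coeff k‖) := by gcongr
      _ = C * (weight k ^ (N + M) * ‖φ.coeff k‖) := by rw [pow_add]; ring
      _ ≤ _ := mul_le_mul_of_nonneg_left h1 hC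

section Dual

variable {E : Type*} [AddCommGroup E] [Module ℂ E] [TopologicalSpace E]

/-- The Fourier coefficients `⟨T, exp (-2 π i k · )⟩` of a (scalar or vector valued)
distribution. -/
def fourierDual (T : TestFunction d →L[ℂ] E) (k : Fin d → ℤ) : E := T (character (-k))

/-- The operator `ℒ_g` on (scalar or vector valued) distributions, as the dual extension of the
multiplier on functions; it multiplies the `k`-th Fourier coefficient by `g(k)`, see
`fourierDual_multiplier`. -/
def multiplier (g : FourierSymbol d) (T : TestFunction d →L[ℂ] E) : TestFunction d →L[ℂ] E :=
  T.comp (transposeMultiplier g)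

lemma fourierDual_multiplier (g : FourierSymbol d) (T : TestFunction d →L[ℂ] E)
    (k : Fin d → ℤ) : fourierDual (multiplier g T) k = g k • fourierDual T k := by
  have : transposeMultiplier g (character (-k)) = g k • character (-k) := by
    refine TestFunction.ext_coeff fun m => ?_
    change (TestFunction.ofCoeff _ (g.rapidDecay _)).coeff m = _
    rw [TestFunction.coeff_ofCoeff, TestFunction.coeff_smul, coeff_character]
    by_cases hm : m = -k
    · simp [hm]
    · simp [hm]
  unfold fourierDual multiplier
  rw [ContinuousLinearMap.comp_apply, this, map_smul]

end Dual

/-- Distributions on the torus. -/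
abbrev Distribution (d : ℕ) : Type := TestFunction d →L[ℂ] ℂ

/-! ### Measures on the frequency lattice -/

/-- Slowly growing positive measures on `ℤ^d`. -/
def IsSlowlyGrowing (μ : Measure (Fin d → ℤ)) : Prop :=
  ∃ N : ℕ, ∑' k, (ENNReal.ofReal (weight k ^ N))⁻¹ * μ {k} < ∞

/-- Even measures on `ℤ^d`. -/
def IsEven (μ : Measure (Fin d → ℤ)) : Prop := ∀ k, μ {-k} = μ {k}

/-- `ρ` is the inverse Fourier transform `∑ₖ μ({k}) exp (2 π i k · x)` of `μ`:
`⟨ρ, φ⟩ = ∑ₖ μ({k}) ∫ φ(x) exp (2 π i k · x) dx` for all test functions. -/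
def IsInverseFourier (μ : Measure (Fin d → ℤ)) (ρ : Distribution d) : Prop :=
  ∀ φ : TestFunction d, HasSum (fun k => ((μ {k}).toReal : ℂ) * φ.coeff (-k)) (ρ φ)

/-- The measure `μ/|g|²` on `ℤ^d`, with mass zero at the zeros of `g`. -/
def divSymbol (μ : Measure (Fin d → ℤ)) (g : FourierSymbol d) : Measure (Fin d → ℤ) :=
  open Classical in
  Measure.sum fun k => (if g k = 0 then 0 else μ {k} / ‖g k‖ₑ ^ 2) • Measure.dirac k

lemma divSymbol_singleton (μ : Measure (Fin d → ℤ)) (g : FourierSymbol d) (k : Fin d → ℤ) :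
    divSymbol μ g {k} = open Classical in if g k = 0 then 0 else μ {k} / ‖g k‖ₑ ^ 2 := by
  classical
  unfold divSymbol
  rw [Measure.sum_apply _ (measurableSet_singleton k), tsum_eq_single k]
  · by_cases hg : g k = 0
    · simp [hg]
    · simp [hg]
  · intro m hm
    have h0 : Measure.dirac m ({k} : Set (Fin d → ℤ)) = 0 := by
      rw [Measure.dirac_apply' _ (measurableSet_singleton k)]
      simp [hm]
    rw [Measure.smul_apply, h0, smul_zero]

/-! ### Generalized random fields -/

section Fields

variable {Ω : Type u} [MeasurableSpace Ω] {Ω' : Type v} [MeasurableSpace Ω']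

/-- Generalized random fields: continuous linear maps from test functions to `L²(Ω, P)`. -/
abbrev RandomField (d : ℕ) (P : Measure Ω) : Type u := TestFunction d →L[ℂ] Lp ℂ 2 P

variable {P : Measure Ω} {Q : Measure Ω'}

/-- The mean `E⟨Z, φ⟩`. -/
def mean (Z : RandomField d P) (φ : TestFunction d) : ℂ := ∫ ω, Z φ ω ∂P

/-- The covariance `Cov(⟨Z, φ⟩, ⟨Z, ψ⟩)`. -/
def covar (Z : RandomField d P) (φ ψ : TestFunction d) : ℂ :=
  ∫ ω, (Z φ ω - mean Z φ) * (starRingEnd ℂ) (Z ψ ω - mean Z ψ) ∂P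

/-- A field is real if `⟨Z, φ̄⟩` is the conjugate of `⟨Z, φ⟩`; equivalently, if it is real valued
on real valued test functions. -/
def IsReal (Z : RandomField d P) : Prop :=
  ∀ φ : TestFunction d, ∀ᵐ ω ∂P, Z φ.conj ω = (starRingEnd ℂ) (Z φ ω)

/-- The field has mean zero. -/
def IsCentered (Z : RandomField d P) : Prop := ∀ φ : TestFunction d, mean Z φ = 0

/-- `ρ` is the covariance distribution of a stationary field:
`Cov(⟨Z, φ⟩, ⟨Z, ψ⟩) = ⟨ρ, φ ∗ ψ̌̄⟩`. -/
def IsCovarianceDistribution (Z : RandomField d P) (ρ : Distribution d) : Prop :=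
  ∀ φ ψ : TestFunction d, covar Z φ ψ = ρ (corr φ ψ)

/-- A real, centered, stationary generalized random field. -/
structure IsRealStationary (Z : RandomField d P) : Prop where
  real : IsReal Z
  centered : IsCentered Z
  stationary : ∃ ρ : Distribution d, IsCovarianceDistribution Z ρ

/-- `μ` is the spectral measure of the stationary field `Z`: a slowly growing positive measure on
`ℤ^d` whose inverse Fourier transform is the covariance distribution of `Z`. -/
def IsSpectralMeasure (Z : RandomField d P) (μ : Measure (Fin d → ℤ)) : Prop :=
  IsSlowlyGrowing μ ∧ ∃ ρ : Distribution d, IsCovarianceDistribution Z ρ ∧ IsInverseFourier μ ρ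

/-- Equality in the second-order sense: same mean and same covariance. The two fields may live on
different probability spaces. -/
def SecondOrderEq (Z : RandomField d P) (W : RandomField d Q) : Prop :=
  (∀ φ : TestFunction d, mean Z φ = mean W φ) ∧
    ∀ φ ψ : TestFunction d, covar Z φ ψ = covar W φ ψ

/-- `U` is a real stationary solution of `ℒ_g U = X` in the second-order sense. -/
def IsSolution (g : FourierSymbol d) (X : RandomField d P) (U : RandomField d Q) : Prop :=
  IsRealStationary U ∧ SecondOrderEq (multiplier g U) X

end Fields

end TorusField

end

open TorusField

namespace TorusField

noncomputable section

/-! ### Distributions with prescribed Fourier coefficients -/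

section Synthesis

/-! Everything happens on the Fourier side. A real centered stationary field with spectral measure
`μ` amounts to a family `V k` in `L²` that is orthogonal, orthogonal to the constants, satisfies `V
(-k) = conj (V k)`, and has `‖V k‖² = μ {k}` (`IsSpectralFamily`). Testing the covariance on
characters yields such a family (`isSpectralFamily_fourierDual`). Conversely, slow growth of `μ`
bounds `V` polynomially, so that `∑ φ̂(-k) V k` converges and defines a continuous field
(`IsSpectralFamily.exists_field`).

The multiplier scales the `k`-th coefficient by `g k`, so for a field with spectral measure `ν` the
equation says exactly `|g|² ν = μ_X` (`isSolution_of_spectral`, `IsSolution.spectral_eq`).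
Summability is necessary because continuity of a solution bounds its coefficients polynomially
(`IsSolution.isSolvable`). It is sufficient because dividing the coefficients of `X` by `g` gives a
spectral family for `μ_X/|g|²` on the same probability space (`IsSolvable.exists_solution`).

A space unrelated to that of `X` needs a model field for an arbitrary even slowly growing measure.
Only second moments matter, so suitably scaled characters on a torus with one extra coordinate serve
as the random variables (`exists_field_of_isEven`).

Where `g` does not vanish, `|g|² ν = μ_X` determines `ν`. At a zero of `g` the mass of `ν` is free,
and adding atoms at `±k` produces a second spectral measure of a solution. -/

lemma nonneg_of_norm_le {d : ℕ} {E : Type*} [NormedAddCommGroup E] {V : (Fin d → ℤ) → E} {C : ℝ} {N : ℕ}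
    (h : ∀ k, ‖V k‖ ≤ C * weight k ^ N) : 0 ≤ C :=
  nonneg_of_mul_nonneg_left ((norm_nonneg _).trans (h 0)) (pow_pos (weight_pos _) _)

variable {d : ℕ} {E : Type*} [NormedAddCommGroup E] [NormedSpace ℂ E]

/-- Polynomial boundedness of a family indexed by the frequency lattice. -/
def IsPolyBounded (V : (Fin d → ℤ) → E) : Prop :=
  ∃ (C : ℝ) (N : ℕ), ∀ k, ‖V k‖ ≤ C * weight k ^ N

/-- Of the `N + d` powers of the weight controlled by the seminorm, `N` absorb the growth of `V` and
`d` leave a summable majorant. The dependence on `φ` is through one seminorm, which later gives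
continuity of the sum. -/
lemma norm_coeff_smul_le {V : (Fin d → ℤ) → E} {C : ℝ} {N : ℕ}
    (h : ∀ k, ‖V k‖ ≤ C * weight k ^ N) (φ : TestFunction d) (k : Fin d → ℤ) :
    ‖φ.coeff (-k) • V k‖ ≤ C * testSeminorm d (N + d) φ * (weight k ^ d)⁻¹ := by
  have hC := nonneg_of_norm_le h
  have h1 := le_testSeminorm φ (N + d) (-k)
  rw [weight_neg, pow_add] at h1
  have hd := pow_pos (weight_pos k) d
  rw [norm_smul, ← div_eq_mul_inv, le_div_iff₀ hd]
  calc ‖φ.coeff (-k)‖ * ‖V k‖ * weight k ^ d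
      ≤ ‖φ.coeff (-k)‖ * (C * weight k ^ N) * weight k ^ d := by gcongr; exact h k
    _ = C * (weight k ^ N * weight k ^ d * ‖φ.coeff (-k)‖) := by ring
    _ ≤ _ := mul_le_mul_of_nonneg_left h1 hC

lemma IsPolyBounded.summable_norm {V : (Fin d → ℤ) → E} (hV : IsPolyBounded V)
    (φ : TestFunction d) : Summable fun k => ‖φ.coeff (-k) • V k‖ := by
  obtain ⟨C, N, h⟩ := hV
  exact Summable.of_nonneg_of_le (fun k => norm_nonneg _) (norm_coeff_smul_le h φ)
    ((summable_weight d).mul_left _)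

/-- The Fourier coefficients of a distribution are polynomially bounded. -/
lemma isPolyBounded_fourierDual (T : TestFunction d →L[ℂ] E) : IsPolyBounded (fourierDual T) := by
  let p : Seminorm ℂ (TestFunction d) := (normSeminorm ℂ E).comp T.toLinearMap
  have hp : Continuous p := continuous_norm.comp T.continuous
  obtain ⟨s, C, -, hC⟩ := Seminorm.bound_of_continuous (withSeminorms d) p hp
  -- The `N`-th seminorm of a character is `weight k ^ N`, and `1 ≤ weight k`, so the largest index
  -- in `s` dominates them all.
  refine ⟨C, s.sup id, fun k => ?_⟩
  have hw : 0 ≤ weight k ^ s.sup id := (pow_pos (weight_pos k) _).le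
  refine (hC (character (-k))).trans (mul_le_mul_of_nonneg_left ?_ C.2)
  refine Seminorm.finset_sup_apply_le hw fun N hN => ?_
  refine ciSup_le fun m => ?_
  rw [coeff_character]
  split_ifs with hm
  · rw [hm, weight_neg, norm_one, mul_one]
    exact pow_le_pow_right₀ (one_le_weight k) (Finset.le_sup (f := id) hN)
  · rwa [norm_zero, mul_zero]

variable [CompleteSpace E]

lemma IsPolyBounded.summable {V : (Fin d → ℤ) → E} (hV : IsPolyBounded V)
    (φ : TestFunction d) : Summable fun k => φ.coeff (-k) • V k :=
  (hV.summable_norm φ).of_norm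

/-- The (vector valued) distribution `φ ↦ ∑ₖ φ̂(-k) Vₖ` with Fourier coefficients `V`. -/
def synthesis (V : (Fin d → ℤ) → E) (hV : IsPolyBounded V) : TestFunction d →L[ℂ] E where
  toFun φ := ∑' k, φ.coeff (-k) • V k
  map_add' φ ψ := by
    rw [← (hV.summable φ).tsum_add (hV.summable ψ)]
    exact tsum_congr fun k => by rw [TestFunction.coeff_add, add_smul]
  map_smul' c φ := by
    rw [RingHom.id_apply, ← (hV.summable φ).tsum_const_smul c]
    exact tsum_congr fun k => by rw [TestFunction.coeff_smul, mul_smul]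
  cont := by
    let L : TestFunction d →ₗ[ℂ] E :=
      { toFun := fun φ => ∑' k, φ.coeff (-k) • V k
        map_add' := fun φ ψ => by
          rw [← (hV.summable φ).tsum_add (hV.summable ψ)]
          exact tsum_congr fun k => by rw [TestFunction.coeff_add, add_smul]
        map_smul' := fun c φ => by
          rw [RingHom.id_apply, ← (hV.summable φ).tsum_const_smul c]
          exact tsum_congr fun k => by rw [TestFunction.coeff_smul, mul_smul] }
    obtain ⟨C, N, h⟩ := hV
    have hC := nonneg_of_norm_le h
    have hS : 0 ≤ ∑' k : Fin d → ℤ, (weight k ^ d)⁻¹ :=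
      tsum_nonneg fun k => (inv_pos.2 (pow_pos (weight_pos k) d)).le
    refine WithSeminorms.continuous_normedSpace_rng E (withSeminorms d) L
      ⟨{N + d}, ⟨C * ∑' k : Fin d → ℤ, (weight k ^ d)⁻¹, mul_nonneg hC hS⟩, fun φ => ?_⟩
    have h1 := tsum_of_norm_bounded ((summable_weight d).mul_left
      (C * testSeminorm d (N + d) φ)).hasSum (norm_coeff_smul_le h φ)
    rw [tsum_mul_left] at h1
    simp only [Finset.sup_singleton]
    change ‖∑' k, φ.coeff (-k) • V k‖ ≤
      (C * ∑' k : Fin d → ℤ, (weight k ^ d)⁻¹) * testSeminorm d (N + d) φ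
    linarith

lemma hasSum_synthesis (V : (Fin d → ℤ) → E) (hV : IsPolyBounded V) (φ : TestFunction d) :
    HasSum (fun k => φ.coeff (-k) • V k) (synthesis V hV φ) :=
  (hV.summable φ).hasSum

end Synthesis

/-! ### Conjugation of test functions on the Fourier side -/

lemma coeff_conj {d : ℕ} (φ : TestFunction d) (k : Fin d → ℤ) :
    φ.conj.coeff k = star (φ.coeff (-k)) := by
  rw [TestFunction.coeff_eq_integral, TestFunction.coeff_eq_integral]
  simp only [Complex.star_def]
  rw [← integral_conj]
  congr 1
  ext t
  rw [map_mul, mFourier_neg, neg_neg, TestFunction.conj_apply]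

lemma conj_character {d : ℕ} (k : Fin d → ℤ) : (character k).conj = character (-k) := by
  refine TestFunction.ext_coeff fun m => ?_
  rw [coeff_conj, coeff_character, coeff_character]
  by_cases h : m = -k
  · simp [h]
  · have : -m ≠ k := fun h' => h (by rw [← h', neg_neg])
    simp [h, this]

/-! ### Second-order calculus in `L²` -/

section SecondOrder

variable {d : ℕ} {Ω : Type u} [MeasurableSpace Ω] {P : Measure Ω}

/-- Complex conjugation on `L²`. -/
def conjL2 (P : Measure Ω) : Lp ℂ 2 P →L[ℝ] Lp ℂ 2 P :=
  (Complex.conjCLE : ℂ →L[ℝ] ℂ).compLpL 2 P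

lemma coeFn_conjL2 (f : Lp ℂ 2 P) : ∀ᵐ ω ∂P, conjL2 P f ω = conj (f ω) :=
  ContinuousLinearMap.coeFn_compLpL _ f

/-- Replaces an almost sure identity by an equation in `L²`, where the continuity of conjugation
lets it pass through infinite sums. -/
lemma conjL2_eq_iff {f h : Lp ℂ 2 P} : h = conjL2 P f ↔ ∀ᵐ ω ∂P, h ω = conj (f ω) := by
  constructor
  · rintro rfl
    exact coeFn_conjL2 f
  · intro hf
    refine Lp.ext ?_
    filter_upwards [hf, coeFn_conjL2 f] with ω h1 h2
    rw [h1, h2]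

lemma conjL2_smul (c : ℂ) (f : Lp ℂ 2 P) : conjL2 P (c • f) = conj c • conjL2 P f := by
  symm
  rw [conjL2_eq_iff]
  filter_upwards [Lp.coeFn_smul (conj c) (conjL2 P f), Lp.coeFn_smul c f, coeFn_conjL2 f]
    with ω h1 h2 h3
  rw [h1, h2, Pi.smul_apply, Pi.smul_apply, h3, smul_eq_mul, smul_eq_mul, map_mul]

lemma isReal_iff (Z : RandomField d P) : IsReal Z ↔ ∀ φ, Z φ.conj = conjL2 P (Z φ) :=
  forall_congr' fun _ => conjL2_eq_iff.symm

lemma inner_eq_integral (f h : Lp ℂ 2 P) : inner ℂ f h = ∫ ω, h ω * conj (f ω) ∂P := rfl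

lemma inner_conjL2 (f h : Lp ℂ 2 P) :
    inner ℂ (conjL2 P f) (conjL2 P h) = conj (inner ℂ f h) := by
  rw [inner_eq_integral, inner_eq_integral, ← integral_conj]
  refine integral_congr_ae ?_
  filter_upwards [coeFn_conjL2 f, coeFn_conjL2 h] with ω h1 h2
  rw [h1, h2, map_mul]

/-- The arguments are swapped because the inner product is conjugate-linear in its first slot. -/
lemma covar_eq_inner {Z : RandomField d P} (hZ : IsCentered Z) (φ ψ : TestFunction d) :
    covar Z φ ψ = inner ℂ (Z ψ) (Z φ) := by
  unfold covar
  rw [hZ φ, hZ ψ]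
  simp only [sub_zero]
  rfl

variable [IsProbabilityMeasure P]

/-- Makes the mean a continuous functional on `L²`, so that it can be computed termwise on a series.
-/
lemma inner_const_one (f : Lp ℂ 2 P) : inner ℂ (Lp.const 2 P (1 : ℂ)) f = ∫ ω, f ω ∂P := by
  rw [inner_eq_integral]
  refine integral_congr_ae ?_
  filter_upwards [Lp.coeFn_const (p := 2) (μ := P) (1 : ℂ)] with ω h
  rw [h, Function.const_apply, map_one, mul_one]

end SecondOrder

variable {d : ℕ}

/-! ### Slowly growing measures -/

/-- The inverse weights are nonzero, so an infinite atom would make the weighted sum infinite. This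
is what allows passing to `toReal` without loss. -/
lemma IsSlowlyGrowing.singleton_ne_top {μ : Measure (Fin d → ℤ)} (hμ : IsSlowlyGrowing μ)
    (k : Fin d → ℤ) : μ {k} ≠ ∞ := by
  obtain ⟨N, hN⟩ := hμ
  have h := (ENNReal.le_tsum k).trans_lt hN
  intro hk
  rw [hk, ENNReal.mul_top (ENNReal.inv_ne_zero.2 ENNReal.ofReal_ne_top)] at h
  exact lt_irrefl _ h

lemma IsSlowlyGrowing.isPolyBounded {μ : Measure (Fin d → ℤ)} (hμ : IsSlowlyGrowing μ) :
    IsPolyBounded fun k => ((μ {k}).toReal : ℂ) := by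
  have hfin := hμ.singleton_ne_top
  obtain ⟨N, hN⟩ := hμ
  refine ⟨(∑' k, (ENNReal.ofReal (weight k ^ N))⁻¹ * μ {k}).toReal, N, fun k => ?_⟩
  have hw := pow_pos (weight_pos k) N
  have h := ENNReal.toReal_mono hN.ne (ENNReal.le_tsum
    (f := fun k => (ENNReal.ofReal (weight k ^ N))⁻¹ * μ {k}) k)
  rw [ENNReal.toReal_mul, ENNReal.toReal_inv, ENNReal.toReal_ofReal hw.le,
    inv_mul_le_iff₀ hw] at h
  rw [Complex.norm_real, Real.norm_of_nonneg ENNReal.toReal_nonneg]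
  linarith

lemma tsum_ofReal_lt_top {f : (Fin d → ℤ) → ℝ≥0∞} {C : ℝ}
    (h : ∀ k, f k ≤ ENNReal.ofReal (C * (weight k ^ d)⁻¹)) : ∑' k, f k < ∞ :=
  (ENNReal.tsum_le_tsum h).trans_lt ((summable_weight d).mul_left C).tsum_ofReal_lt_top

/-! ### Fields with prescribed Fourier coefficients -/

section Fields

variable {Ω : Type u} [MeasurableSpace Ω] {P : Measure Ω} {Ω' : Type v} [MeasurableSpace Ω']
  {Q : Measure Ω'}

lemma inner_self_eq_ofReal (f : Lp ℂ 2 P) : inner ℂ f f = ((‖f‖ ^ 2 : ℝ) : ℂ) := by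
  rw [inner_self_eq_norm_sq_to_K]
  push_cast
  rfl

/-- The mean and covariance relations between the Fourier coefficients of a real centered
stationary field with spectral measure `μ`. -/
structure IsSpectralFamily [IsProbabilityMeasure P] (V : (Fin d → ℤ) → Lp ℂ 2 P)
    (μ : Measure (Fin d → ℤ)) : Prop where
  mean_zero : ∀ k, inner ℂ (Lp.const 2 P (1 : ℂ)) (V k) = 0
  neg_eq : ∀ k, V (-k) = conjL2 P (V k)
  inner_eq : ∀ k m, inner ℂ (V m) (V k) = if k = m then ((μ {k}).toReal : ℂ) else 0

lemma IsSpectralMeasure.hasSum_covar {Z : RandomField d P} {μ : Measure (Fin d → ℤ)}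
    (h : IsSpectralMeasure Z μ) (φ ψ : TestFunction d) :
    HasSum (fun k => ((μ {k}).toReal : ℂ) * (φ.coeff (-k) * star (ψ.coeff (-k))))
      (covar Z φ ψ) := by
  obtain ⟨-, ρ, h1, h2⟩ := h
  rw [h1]
  refine (h2 (corr φ ψ)).congr_fun fun k => ?_
  rw [coeff_corr]

/-- Characters isolate single frequencies in the spectral series: only the index `n = k` can
contribute, and only when `m = k` as well. -/
lemma IsSpectralMeasure.covar_character {Z : RandomField d P} {μ : Measure (Fin d → ℤ)}
    (h : IsSpectralMeasure Z μ) (k m : Fin d → ℤ) :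
    covar Z (character (-k)) (character (-m)) = if k = m then ((μ {k}).toReal : ℂ) else 0 := by
  refine (h.hasSum_covar _ _).unique ?_
  have : (fun n => ((μ {n}).toReal : ℂ) * ((character (-k)).coeff (-n) *
      star ((character (-m)).coeff (-n)))) =
      fun n => if n = k then if k = m then ((μ {k}).toReal : ℂ) else 0 else 0 := by
    ext n
    simp only [coeff_character, neg_inj]
    by_cases hn : n = k
    · subst hn
      by_cases hm : n = m <;> simp [hm]
    · simp [hn]
  rw [this]
  exact hasSum_ite_eq k _

lemma isSpectralFamily_fourierDual [IsProbabilityMeasure P] {Z : RandomField d P}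
    {μ : Measure (Fin d → ℤ)} (hZ : IsRealStationary Z) (hμ : IsSpectralMeasure Z μ) :
    IsSpectralFamily (fourierDual Z) μ where
  mean_zero k := by
    rw [inner_const_one]
    exact hZ.centered _
  neg_eq k := by
    unfold fourierDual
    rw [← (isReal_iff Z).1 hZ.real, conj_character]
  inner_eq k m := by
    unfold fourierDual
    rw [← covar_eq_inner hZ.centered, hμ.covar_character]

lemma IsSpectralFamily.norm_sq [IsProbabilityMeasure P] {V : (Fin d → ℤ) → Lp ℂ 2 P}
    {μ : Measure (Fin d → ℤ)} (hV : IsSpectralFamily V μ) (k : Fin d → ℤ) :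
    ‖V k‖ ^ 2 = (μ {k}).toReal := by
  have h := hV.inner_eq k k
  rw [if_pos rfl, inner_self_eq_ofReal] at h
  exact Complex.ofReal_injective h

lemma IsSpectralFamily.toReal_neg [IsProbabilityMeasure P] {V : (Fin d → ℤ) → Lp ℂ 2 P}
    {μ : Measure (Fin d → ℤ)} (hV : IsSpectralFamily V μ) (k : Fin d → ℤ) :
    (μ {-k}).toReal = (μ {k}).toReal := by
  have h := hV.inner_eq (-k) (-k)
  rw [hV.neg_eq, inner_conjL2, hV.inner_eq, if_pos rfl, if_pos rfl, Complex.conj_ofReal] at h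
  exact_mod_cast h.symm

lemma IsSpectralFamily.isPolyBounded [IsProbabilityMeasure P] {V : (Fin d → ℤ) → Lp ℂ 2 P}
    {μ : Measure (Fin d → ℤ)} (hV : IsSpectralFamily V μ) (hμ : IsSlowlyGrowing μ) :
    IsPolyBounded V := by
  obtain ⟨C, N, h⟩ := hμ.isPolyBounded
  -- Only `‖V k‖²` is controlled; `t ≤ 1 + t²` together with `1 ≤ weight k ^ N` gives the constant
  -- `1 + C`.
  refine ⟨1 + C, N, fun k => ?_⟩
  have h1 := h k
  rw [Complex.norm_real, Real.norm_of_nonneg ENNReal.toReal_nonneg, ← hV.norm_sq] at h1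
  have h2 : 1 ≤ weight k ^ N := one_le_pow₀ (one_le_weight k)
  nlinarith [sq_nonneg (‖V k‖ - 1)]

/-- A spectral family for a slowly growing measure `μ` is the family of Fourier coefficients of a
real centered stationary field with spectral measure `μ`. -/
theorem IsSpectralFamily.exists_field [IsProbabilityMeasure P] {V : (Fin d → ℤ) → Lp ℂ 2 P}
    {μ : Measure (Fin d → ℤ)} (hV : IsSpectralFamily V μ) (hμ : IsSlowlyGrowing μ) :
    ∃ U : RandomField d P, IsRealStationary U ∧ IsSpectralMeasure U μ := by
  have hb := hV.isPolyBounded hμ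
  let U : RandomField d P := synthesis V hb
  let ρ : Distribution d := synthesis _ hμ.isPolyBounded
  have hU : ∀ φ, HasSum (fun k => φ.coeff (-k) • V k) (U φ) := hasSum_synthesis V hb
  have hcent : IsCentered U := by
    intro φ
    have h := (innerSL ℂ (Lp.const 2 P (1 : ℂ))).hasSum (hU φ)
    simp only [map_smul, innerSL_apply_apply, hV.mean_zero, smul_zero] at h
    rw [mean, ← inner_const_one]
    exact h.unique hasSum_zero
  have hcov : IsCovarianceDistribution U ρ := by
    intro φ ψ
    rw [covar_eq_inner hcent]
    -- The double series for the covariance is never formed: by orthogonality the series of `U φ`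
    -- collapses against one `V m`, and afterwards only `U ψ` is expanded.
    have hm : ∀ m, inner ℂ (V m) (U φ) = φ.coeff (-m) * ((μ {m}).toReal : ℂ) := by
      intro m
      have h := (innerSL ℂ (V m)).hasSum (hU φ)
      refine h.unique ?_
      have : (fun k => innerSL ℂ (V m) (φ.coeff (-k) • V k)) =
          fun k => if k = m then φ.coeff (-m) * ((μ {m}).toReal : ℂ) else 0 := by
        ext k
        rw [map_smul, innerSL_apply_apply, hV.inner_eq, smul_eq_mul]
        by_cases hk : k = m <;> simp [hk]
      rw [this]
      exact hasSum_ite_eq m _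
    have h := ((innerSL ℂ (U φ)).hasSum (hU ψ)).star
    have h' := hasSum_synthesis _ hμ.isPolyBounded (corr φ ψ)
    refine HasSum.unique ?_ h'
    simp only [innerSL_apply_apply, Complex.star_def, inner_conj_symm] at h
    refine h.congr_fun fun k => ?_
    rw [inner_smul_left, hm, coeff_corr, smul_eq_mul, Complex.star_def]
    ring
  refine ⟨U, ⟨(isReal_iff U).2 fun φ => ?_, hcent, ρ, hcov⟩, hμ, ρ, hcov, fun φ => ?_⟩
  · refine (hU φ.conj).unique ?_
    -- Conjugation carries `V k` to `V (-k)`, so the two series agree after the reindexing `k ↦ -k`.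
    rw [← (Equiv.neg _).hasSum_iff]
    refine ((conjL2 P).hasSum (hU φ)).congr_fun fun k => ?_
    simp only [Function.comp_apply, Equiv.neg_apply]
    rw [conjL2_smul, hV.neg_eq, coeff_conj, neg_neg, Complex.star_def]
  · refine (hasSum_synthesis _ hμ.isPolyBounded φ).congr_fun fun k => ?_
    rw [smul_eq_mul, mul_comm]

/-! ### Spectral characterisation of solutions -/

lemma coeff_transposeMultiplier (g : FourierSymbol d) (φ : TestFunction d) (k : Fin d → ℤ) :
    (transposeMultiplier g φ).coeff (-k) = g k * φ.coeff (-k) := by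
  change (TestFunction.ofCoeff _ (g.rapidDecay φ)).coeff (-k) = _
  rw [TestFunction.coeff_ofCoeff, neg_neg]

/-- A stationary field whose spectral measure `ν` satisfies `|g|² ν = μ` solves the equation. -/
theorem isSolution_of_spectral {g : FourierSymbol d} {X : RandomField d P} {U : RandomField d Q}
    {μ ν : Measure (Fin d → ℤ)} (hX : IsRealStationary X) (hμ : IsSpectralMeasure X μ)
    (hU : IsRealStationary U) (hν : IsSpectralMeasure U ν)
    (h : ∀ k, ‖g k‖ ^ 2 * (ν {k}).toReal = (μ {k}).toReal) : IsSolution g X U := by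
  refine ⟨hU, fun φ => (hU.centered _).trans (hX.centered φ).symm, fun φ ψ => ?_⟩
  have hc : covar (multiplier g U) φ ψ =
      covar U (transposeMultiplier g φ) (transposeMultiplier g ψ) := rfl
  rw [hc]
  refine (hν.hasSum_covar _ _).unique ?_
  refine (hμ.hasSum_covar φ ψ).congr_fun fun k => ?_
  rw [coeff_transposeMultiplier, coeff_transposeMultiplier, ← h k, Complex.star_def,
    map_mul]
  push_cast
  -- The two slots of the covariance contribute `g k` and its conjugate, whose product is `|g k|²`.
  rw [← Complex.mul_conj']
  ring

/-- The second moments of the Fourier coefficients of a solution. -/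
lemma IsSolution.norm_sq_fourierDual {g : FourierSymbol d} {X : RandomField d P}
    {U : RandomField d Q} {μ : Measure (Fin d → ℤ)} (h : IsSolution g X U)
    (hμ : IsSpectralMeasure X μ) (k : Fin d → ℤ) :
    ‖g k‖ ^ 2 * ‖fourierDual U k‖ ^ 2 = (μ {k}).toReal := by
  have h1 := h.2.2 (character (-k)) (character (-k))
  have hc : IsCentered (multiplier g U) := fun φ => h.1.centered _
  rw [hμ.covar_character, if_pos rfl, covar_eq_inner hc, inner_self_eq_ofReal] at h1
  have h2 := Complex.ofReal_injective h1
  change ‖fourierDual (multiplier g U) k‖ ^ 2 = _ at h2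
  rwa [fourierDual_multiplier, norm_smul, mul_pow] at h2

/-- The mass `ν {k}` is the second moment of the `k`-th Fourier coefficient of `U`, which the
equation ties to `μ {k}`. -/
lemma IsSolution.spectral_eq {g : FourierSymbol d} {X : RandomField d P}
    {U : RandomField d Q} {μ ν : Measure (Fin d → ℤ)} (h : IsSolution g X U)
    (hμ : IsSpectralMeasure X μ) (hν : IsSpectralMeasure U ν) (k : Fin d → ℤ) :
    ‖g k‖ ^ 2 * (ν {k}).toReal = (μ {k}).toReal := by
  have h1 := h.norm_sq_fourierDual hμ k
  have h2 := hν.covar_character k k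
  rw [if_pos rfl, covar_eq_inner h.1.centered, inner_self_eq_ofReal] at h2
  have h3 : ‖U (character (-k))‖ ^ 2 = (ν {k}).toReal := Complex.ofReal_injective h2
  rw [← h3, ← h1]
  rfl

end Fields

/-! ### Existence of fields with a given spectral measure -/

section Existence

instance isProbabilityMeasure_haar (d : ℕ) : IsProbabilityMeasure (haar d) := by
  unfold haar
  infer_instance

/-- The torus, lifted to an arbitrary universe. -/
abbrev LiftedTorus (n : ℕ) : Type v := ULift.{v, 0} (UnitAddTorus (Fin n))

/-- The probability Haar measure of the lifted torus. -/
def liftedHaar (n : ℕ) : Measure (LiftedTorus.{v} n) := (haar n).map ULift.up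

instance isProbabilityMeasure_liftedHaar (n : ℕ) :
    IsProbabilityMeasure (liftedHaar.{v} n) :=
  Measure.isProbabilityMeasure_map measurable_up.aemeasurable

lemma integral_liftedHaar {n : ℕ} (f : UnitAddTorus (Fin n) → ℂ) :
    ∫ ω, f ω.down ∂(liftedHaar.{v} n) = ∫ x, f x ∂(haar n) :=
  integral_map_equiv MeasurableEquiv.ulift.symm _

/-- The characters as elements of `L²` of the lifted torus. -/
def liftedCharacter {n : ℕ} (m : Fin n → ℤ) : Lp ℂ 2 (liftedHaar.{v} n) :=
  MemLp.toLp (fun ω => mFourier m ω.down)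
    (MemLp.of_bound (((mFourier m).continuous.measurable.comp
      measurable_down).aestronglyMeasurable) 1
      (Filter.Eventually.of_forall fun ω =>
        ((mFourier m).norm_coe_le_norm ω.down).trans mFourier_norm.le))

lemma coeFn_liftedCharacter {n : ℕ} (m : Fin n → ℤ) :
    ∀ᵐ ω ∂(liftedHaar.{v} n), liftedCharacter m ω = mFourier m ω.down :=
  MemLp.coeFn_toLp _

lemma inner_liftedCharacter {n : ℕ} (m k : Fin n → ℤ) :
    inner ℂ (liftedCharacter.{v} m) (liftedCharacter k) = if m = k then (1 : ℂ) else 0 := by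
  rw [inner_eq_integral, ← coeff_mFourier]
  change _ = ∫ t, mFourier (-m) t * mFourier k t ∂(haar n)
  rw [← integral_liftedHaar.{v}]
  refine integral_congr_ae ?_
  filter_upwards [coeFn_liftedCharacter m, coeFn_liftedCharacter k] with ω h1 h2
  rw [h1, h2, mFourier_neg, mul_comm]

lemma liftedCharacter_zero {n : ℕ} :
    liftedCharacter.{v} (0 : Fin n → ℤ) = Lp.const 2 (liftedHaar.{v} n) (1 : ℂ) := by
  refine Lp.ext ?_
  filter_upwards [coeFn_liftedCharacter (0 : Fin n → ℤ),
    Lp.coeFn_const (p := 2) (μ := liftedHaar.{v} n) (1 : ℂ)] with ω h1 h2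
  rw [h1, h2, mFourier_zero]
  rfl

lemma conjL2_liftedCharacter {n : ℕ} (m : Fin n → ℤ) :
    conjL2 _ (liftedCharacter.{v} m) = liftedCharacter (-m) := by
  symm
  rw [conjL2_eq_iff]
  filter_upwards [coeFn_liftedCharacter m, coeFn_liftedCharacter (-m)] with ω h1 h2
  rw [h1, h2, mFourier_neg]

lemma neg_cons {n : ℕ} (a : ℤ) (k : Fin n → ℤ) :
    -(Fin.cons a k : Fin (n + 1) → ℤ) = Fin.cons (-a) (-k) := by
  ext i
  refine Fin.cases ?_ (fun j => ?_) i <;> simp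

/-- The orthonormal family `√2 cos(2 π y) exp (2 π i k · x)` on the torus of one dimension more. -/
def modulatedCharacter (k : Fin d → ℤ) : Lp ℂ 2 (liftedHaar.{v} (d + 1)) :=
  ((√2 : ℝ) : ℂ)⁻¹ • (liftedCharacter (Fin.cons 1 k) + liftedCharacter (Fin.cons (-1) k))

/-- Of the four inner products the mixed ones vanish, since the extra frequencies `1` and `-1`
differ; for `k = m` the other two contribute `1/2` each. -/
lemma inner_modulatedCharacter (m k : Fin d → ℤ) :
    inner ℂ (modulatedCharacter.{v} m) (modulatedCharacter k) =
      if k = m then (1 : ℂ) else 0 := by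
  have h2 : ((√2 : ℝ) : ℂ)⁻¹ * ((√2 : ℝ) : ℂ)⁻¹ * 2 = 1 := by
    have h : ((√2 : ℝ) : ℂ) * ((√2 : ℝ) : ℂ) = 2 := by
      rw [← Complex.ofReal_mul, Real.mul_self_sqrt (by norm_num)]
      norm_num
    rw [← mul_inv, h]
    norm_num
  unfold modulatedCharacter
  rw [inner_smul_left, inner_smul_right, inner_add_left, inner_add_right, inner_add_right]
  simp only [inner_liftedCharacter, Fin.cons_inj, map_inv₀, Complex.conj_ofReal]
  by_cases hk : k = m
  · subst hk
    norm_num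
    linear_combination h2
  · have : m ≠ k := Ne.symm hk
    simp [hk, this]

/-- The cosine factor is real: conjugation flips the sign of the extra frequency and so exchanges
the two summands. -/
lemma conjL2_modulatedCharacter (k : Fin d → ℤ) :
    conjL2 _ (modulatedCharacter.{v} k) = modulatedCharacter (-k) := by
  unfold modulatedCharacter
  rw [conjL2_smul, map_add, conjL2_liftedCharacter, conjL2_liftedCharacter, neg_cons, neg_cons,
    neg_neg, map_inv₀, Complex.conj_ofReal, add_comm (liftedCharacter (Fin.cons (-1) (-k)))]

/-- This is the purpose of the extra coordinate. Its frequency is `±1`, so the variable has mean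
zero even for `k = 0`, where the plain character would be constant. -/
lemma inner_const_modulatedCharacter (k : Fin d → ℤ) :
    inner ℂ (Lp.const 2 (liftedHaar.{v} (d + 1)) (1 : ℂ)) (modulatedCharacter k) = 0 := by
  have h : ∀ a : ℤ, a ≠ 0 → (0 : Fin (d + 1) → ℤ) ≠ Fin.cons a k := fun a ha h0 =>
    ha (by simpa using (congrFun h0 0).symm)
  unfold modulatedCharacter
  rw [← liftedCharacter_zero, inner_smul_right, inner_add_right, inner_liftedCharacter,
    inner_liftedCharacter, if_neg (h 1 one_ne_zero), if_neg (h (-1) (by norm_num)), add_zero,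
    mul_zero]

/-- Every slowly growing even measure is a spectral measure. -/
theorem exists_field_of_isEven {μ : Measure (Fin d → ℤ)} (hμ : IsSlowlyGrowing μ)
    (he : IsEven μ) :
    ∃ (Ω' : Type v) (_ : MeasurableSpace Ω') (Q : Measure Ω') (_ : IsProbabilityMeasure Q)
      (U : RandomField d Q), IsRealStationary U ∧ IsSpectralMeasure U μ := by
  have hV : IsSpectralFamily
      (fun k => ((√(μ {k}).toReal : ℝ) : ℂ) • modulatedCharacter.{v} k) μ :=
    { mean_zero := fun k => by
        rw [inner_smul_right, inner_const_modulatedCharacter, mul_zero]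
      -- Evenness of `μ` enters here: the amplitudes at `k` and `-k` must coincide for the field to
      -- be real.
      neg_eq := fun k => by
        rw [conjL2_smul, conjL2_modulatedCharacter, he k, Complex.conj_ofReal]
      inner_eq := fun k m => by
        rw [inner_smul_left, inner_smul_right, inner_modulatedCharacter, Complex.conj_ofReal]
        by_cases hk : k = m
        · subst hk
          rw [if_pos rfl, if_pos rfl, mul_one, ← Complex.ofReal_mul,
            Real.mul_self_sqrt ENNReal.toReal_nonneg]
        · rw [if_neg hk, if_neg hk, mul_zero, mul_zero] }
  obtain ⟨U, hU⟩ := hV.exists_field hμ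
  exact ⟨_, _, _, inferInstance, U, hU⟩

end Existence

/-! ### The quotient measure -/

section Solvability

variable {Ω : Type u} [MeasurableSpace Ω] {P : Measure Ω} {Ω' : Type v} [MeasurableSpace Ω']
  {Q : Measure Ω'}

/-- The summability condition which characterises solvability. -/
def IsSolvable (μ : Measure (Fin d → ℤ)) (g : FourierSymbol d) : Prop :=
  ∃ N : ℕ, ∑' k, μ {k} / (‖g k‖ₑ ^ 2 * ENNReal.ofReal (weight k ^ N)) < ∞

lemma IsEven.of_isSpectralMeasure [IsProbabilityMeasure P] {X : RandomField d P}
    {μ : Measure (Fin d → ℤ)} (hX : IsRealStationary X) (hμ : IsSpectralMeasure X μ) :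
    IsEven μ := fun k =>
  (ENNReal.toReal_eq_toReal_iff' (hμ.1.singleton_ne_top _) (hμ.1.singleton_ne_top _)).1
    ((isSpectralFamily_fourierDual hX hμ).toReal_neg k)

lemma norm_symbol_neg (g : FourierSymbol d) (k : Fin d → ℤ) : ‖g (-k)‖ = ‖g k‖ := by
  rw [g.hermitian, RCLike.norm_conj]

lemma IsEven.divSymbol {μ : Measure (Fin d → ℤ)} (hμ : IsEven μ) (g : FourierSymbol d) :
    IsEven (divSymbol μ g) := fun k => by
  classical
  have h := norm_symbol_neg g k
  rw [divSymbol_singleton, divSymbol_singleton, hμ k, ← enorm_norm (g (-k)), h, enorm_norm]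
  have h0 : g (-k) = 0 ↔ g k = 0 := by rw [← norm_eq_zero, h, norm_eq_zero]
  simp only [h0]

/-- The same exponent works: the two series agree termwise off the zeros of `g`, and at the zeros
the quotient measure has no mass. -/
lemma IsSolvable.isSlowlyGrowing_divSymbol {μ : Measure (Fin d → ℤ)} {g : FourierSymbol d}
    (h : IsSolvable μ g) : IsSlowlyGrowing (divSymbol μ g) := by
  classical
  obtain ⟨N, hN⟩ := h
  refine ⟨N, (ENNReal.tsum_le_tsum fun k => ?_).trans_lt hN⟩
  rw [divSymbol_singleton]
  by_cases hg : g k = 0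
  · simp [hg]
  · have h0 : ‖g k‖ₑ ^ 2 ≠ 0 := pow_ne_zero _ (enorm_ne_zero.2 hg)
    have h1 : ‖g k‖ₑ ^ 2 ≠ ∞ := ENNReal.pow_ne_top enorm_ne_top
    rw [if_neg hg, div_eq_mul_inv, div_eq_mul_inv,
      ENNReal.mul_inv (Or.inl h0) (Or.inl h1)]
    exact le_of_eq (by ring)

/-- In `ℝ≥0∞` a nonzero mass divided by zero is `∞`, which a finite sum excludes; `0 / 0 = 0` is the
other half of the convention. -/
lemma IsSolvable.eq_zero {μ : Measure (Fin d → ℤ)} {g : FourierSymbol d}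
    (h : IsSolvable μ g) {k : Fin d → ℤ} (hk : g k = 0) : μ {k} = 0 := by
  obtain ⟨N, hN⟩ := h
  have h1 := (ENNReal.le_tsum k).trans_lt hN
  by_contra h0
  rw [hk, enorm_zero, zero_pow two_ne_zero, zero_mul, ENNReal.div_zero h0] at h1
  exact lt_irrefl _ h1

/-- No case distinction is needed, since real division by zero returns the mass `0` prescribed at
the zeros of `g`. -/
lemma toReal_divSymbol (μ : Measure (Fin d → ℤ)) (g : FourierSymbol d) (k : Fin d → ℤ) :
    (divSymbol μ g {k}).toReal = (μ {k}).toReal / ‖g k‖ ^ 2 := by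
  classical
  rw [divSymbol_singleton]
  by_cases hg : g k = 0
  · simp [hg]
  · rw [if_neg hg, ENNReal.toReal_div, ENNReal.toReal_pow, toReal_enorm]

lemma IsSolvable.norm_sq_mul_divSymbol {μ : Measure (Fin d → ℤ)} {g : FourierSymbol d}
    (h : IsSolvable μ g) (k : Fin d → ℤ) :
    ‖g k‖ ^ 2 * (divSymbol μ g {k}).toReal = (μ {k}).toReal := by
  rw [toReal_divSymbol]
  by_cases hg : g k = 0
  · simp [h.eq_zero hg]
  · exact mul_div_cancel₀ _ (pow_ne_zero _ (norm_ne_zero_iff.2 hg))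

/-- Off the zeros of `g`, `μ {k} / |g k|²` is the second moment of a Fourier coefficient of `U`,
hence polynomially bounded. At a zero, the equation forces `μ {k} = 0`. -/
lemma IsSolution.isSolvable {g : FourierSymbol d} {X : RandomField d P} {U : RandomField d Q}
    {μ : Measure (Fin d → ℤ)} (h : IsSolution g X U) (hμ : IsSpectralMeasure X μ) :
    IsSolvable μ g := by
  obtain ⟨C, N, hb⟩ := isPolyBounded_fourierDual U
  -- The power `2 * N` cancels the square of the bound on the coefficients, and the remaining `d`
  -- powers make the series converge.
  refine ⟨2 * N + d, tsum_ofReal_lt_top (C := C ^ 2) fun k => ?_⟩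
  have hk := h.norm_sq_fourierDual hμ k
  have hw := weight_pos k
  have hfin := hμ.1.singleton_ne_top k
  by_cases hg : g k = 0
  · have h0 : μ {k} = 0 := by
      rw [hg, norm_zero, zero_pow two_ne_zero, zero_mul] at hk
      exact ((ENNReal.toReal_eq_zero_iff _).1 hk.symm).resolve_right hfin
    rw [h0, ENNReal.zero_div]
    exact zero_le
  · have hg' : 0 < ‖g k‖ := norm_pos_iff.2 hg
    have hwN := pow_pos hw (2 * N + d)
    rw [← ENNReal.ofReal_toReal hfin, ← ofReal_norm, ← ENNReal.ofReal_pow hg'.le,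
      ← ENNReal.ofReal_mul (by positivity), ← ENNReal.ofReal_div_of_pos (by positivity), ← hk]
    refine ENNReal.ofReal_le_ofReal ?_
    have h1 : ‖fourierDual U k‖ ^ 2 ≤ (C * weight k ^ N) ^ 2 :=
      pow_le_pow_left₀ (norm_nonneg _) (hb k) 2
    rw [mul_div_mul_left _ _ (pow_pos hg' 2).ne', div_le_iff₀ hwN]
    refine h1.trans (le_of_eq ?_)
    rw [pow_add, pow_mul']
    field_simp

/-- Under the summability condition the equation is solvable on the probability space of the
right-hand side. -/
theorem IsSolvable.exists_solution [IsProbabilityMeasure P] {g : FourierSymbol d}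
    {X : RandomField d P} {μ : Measure (Fin d → ℤ)} (h : IsSolvable μ g)
    (hX : IsRealStationary X) (hμ : IsSpectralMeasure X μ) :
    ∃ U : RandomField d P, IsSolution g X U := by
  have hF := isSpectralFamily_fourierDual hX hμ
  -- At a zero of `g` the inverse is `0`, so the coefficient is dropped, in accordance with the
  -- vanishing mass of `divSymbol μ g`.
  have hV : IsSpectralFamily (fun k => (g k)⁻¹ • fourierDual X k) (divSymbol μ g) :=
    { mean_zero := fun k => by rw [inner_smul_right, hF.mean_zero, mul_zero]
      neg_eq := fun k => by rw [conjL2_smul, hF.neg_eq, g.hermitian, map_inv₀]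
      inner_eq := fun k m => by
        rw [inner_smul_left, inner_smul_right, hF.inner_eq]
        by_cases hk : k = m
        · subst hk
          rw [if_pos rfl, if_pos rfl, toReal_divSymbol, map_inv₀]
          push_cast
          rw [← Complex.conj_mul', div_eq_inv_mul, mul_inv, mul_assoc]
        · rw [if_neg hk, if_neg hk, mul_zero, mul_zero] }
  obtain ⟨U, hU, hU'⟩ := hV.exists_field h.isSlowlyGrowing_divSymbol
  exact ⟨U, isSolution_of_spectral hX hμ hU hU' h.norm_sq_mul_divSymbol⟩

/-! ### Adding mass at a zero of the symbol -/

/-- The measure `μ + δₘ + δ₋ₘ`. -/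
def addAtoms (μ : Measure (Fin d → ℤ)) (m : Fin d → ℤ) : Measure (Fin d → ℤ) :=
  μ + (Measure.dirac m + Measure.dirac (-m))

/-- Two separate indicators also cover `m = 0`, where the atoms coincide and the added mass is `2`.
-/
lemma addAtoms_singleton (μ : Measure (Fin d → ℤ)) (m k : Fin d → ℤ) :
    addAtoms μ m {k} = μ {k} + ((if m = k then 1 else 0) + if -m = k then 1 else 0) := by
  unfold addAtoms
  rw [Measure.add_apply, Measure.add_apply, Measure.dirac_apply' _ (measurableSet_singleton k),
    Measure.dirac_apply' _ (measurableSet_singleton k)]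
  simp only [Set.indicator_apply, Set.mem_singleton_iff, Pi.one_apply]

lemma IsEven.addAtoms {μ : Measure (Fin d → ℤ)} (hμ : IsEven μ) (m : Fin d → ℤ) :
    IsEven (addAtoms μ m) := fun k => by
  rw [addAtoms_singleton, addAtoms_singleton, hμ k]
  have : m = -k ↔ -m = k := ⟨fun h => by rw [h, neg_neg], fun h => by rw [← h, neg_neg]⟩
  simp only [this, neg_inj]
  rw [add_comm (if -m = k then 1 else 0)]

lemma IsSlowlyGrowing.addAtoms {μ : Measure (Fin d → ℤ)} (hμ : IsSlowlyGrowing μ)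
    (m : Fin d → ℤ) : IsSlowlyGrowing (addAtoms μ m) := by
  obtain ⟨N, hN⟩ := hμ
  refine ⟨N, ?_⟩
  have hw : ∀ k : Fin d → ℤ, (ENNReal.ofReal (weight k ^ N))⁻¹ ≠ ∞ := fun k =>
    ENNReal.inv_ne_top.2 (ENNReal.ofReal_pos.2 (pow_pos (weight_pos k) N)).ne'
  have hs : ∀ a : Fin d → ℤ,
      ∑' k, (ENNReal.ofReal (weight k ^ N))⁻¹ * (if a = k then 1 else 0) < ∞ := fun a => by
    simp only [mul_ite, mul_one, mul_zero]
    rw [tsum_ite_eq' a]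
    exact (hw a).lt_top
  simp only [addAtoms_singleton, mul_add]
  rw [ENNReal.tsum_add, ENNReal.tsum_add]
  exact ENNReal.add_lt_top.2 ⟨hN, ENNReal.add_lt_top.2 ⟨hs m, hs (-m)⟩⟩

end Solvability

end

end TorusField

/-! ### The existence and uniqueness theorem -/

theorem theoremA (d : ℕ) (Ω : Type u) [MeasurableSpace Ω] (P : Measure Ω)
    [IsProbabilityMeasure P] (X : RandomField d P)
    (hX : IsRealStationary X) (μX : Measure (Fin d → ℤ))
    (hμX : IsSpectralMeasure X μX) (g : FourierSymbol d) :
    -- (i) solvability, with the solution on the probability space of `X` or on any other one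
    ((∃ U : RandomField d P, IsSolution g X U) ↔
      ∃ N : ℕ, ∑' k, μX {k} /
        (‖g k‖ₑ ^ 2 * ENNReal.ofReal (weight k ^ N)) < ∞) ∧
    ((∃ (Ω' : Type v) (_ : MeasurableSpace Ω') (Q : Measure Ω')
        (_ : IsProbabilityMeasure Q) (U : RandomField d Q),
        IsSolution g X U) ↔
      ∃ N : ℕ, ∑' k, μX {k} /
        (‖g k‖ₑ ^ 2 * ENNReal.ofReal (weight k ^ N)) < ∞) ∧
    ((∃ (Ω' : Type v) (_ : MeasurableSpace Ω') (Q : Measure Ω')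
        (_ : IsProbabilityMeasure Q) (U : RandomField d Q),
        IsSolution g X U) →
      -- (ii) `μX / |g|²` is a spectral measure, and every field which has it is a solution
      (IsSlowlyGrowing (divSymbol μX g) ∧
        IsEven (divSymbol μX g) ∧
        (∃ (Ω' : Type v) (_ : MeasurableSpace Ω') (Q : Measure Ω')
          (_ : IsProbabilityMeasure Q) (U : RandomField d Q),
          IsRealStationary U ∧
            IsSpectralMeasure U (divSymbol μX g)) ∧
        ∀ (Ω' : Type v) [MeasurableSpace Ω'] (Q : Measure Ω')
          [IsProbabilityMeasure Q] (U : RandomField d Q),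
          IsRealStationary U →
            IsSpectralMeasure U (divSymbol μX g) →
              IsSolution g X U) ∧
      -- (iii) uniqueness of the spectral measure of the solutions
      ((∃! μ : Measure (Fin d → ℤ),
          ∃ (Ω' : Type v) (_ : MeasurableSpace Ω') (Q : Measure Ω')
            (_ : IsProbabilityMeasure Q) (U : RandomField d Q),
            IsSolution g X U ∧ IsSpectralMeasure U μ) ↔
        ∀ k, 0 < ‖g k‖)) := by

  -- The universe `v` is independent of that of `Ω`, so a solution on the space of `X` cannot be
  -- reused; the model field for `μX / |g|²` is taken instead.
  have key : (∃ (Ω' : Type v) (_ : MeasurableSpace Ω') (Q : Measure Ω')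
      (_ : IsProbabilityMeasure Q) (U : RandomField d Q), IsSolution g X U) ↔
      IsSolvable μX g := by
    constructor
    · rintro ⟨Ω', _, Q, _, U, hU⟩
      exact hU.isSolvable hμX
    · intro h
      obtain ⟨Ω', i₁, Q, i₂, U, hU, hU'⟩ := exists_field_of_isEven.{v}
        h.isSlowlyGrowing_divSymbol ((IsEven.of_isSpectralMeasure hX hμX).divSymbol g)
      exact ⟨Ω', i₁, Q, i₂, U,
        isSolution_of_spectral hX hμX hU hU' h.norm_sq_mul_divSymbol⟩
  refine ⟨⟨fun ⟨U, hU⟩ => hU.isSolvable hμX, fun h => IsSolvable.exists_solution h hX hμX⟩,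
    key, fun hex => ?_⟩
  have hs := key.1 hex
  have hslow := hs.isSlowlyGrowing_divSymbol
  have heven := (IsEven.of_isSpectralMeasure hX hμX).divSymbol g
  refine ⟨⟨hslow, heven, exists_field_of_isEven hslow heven, fun Ω' _ Q _ U hU hU' =>
    isSolution_of_spectral hX hμX hU hU' hs.norm_sq_mul_divSymbol⟩, ?_, ?_⟩
  · intro huniq k
    rw [norm_pos_iff]
    intro hk
    -- Evenness forces atoms at both `k` and `-k`; hermitian symmetry makes both invisible to the
    -- equation.
    have hk' : g (-k) = 0 := by rw [g.hermitian, hk, map_zero]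
    obtain ⟨Ω₁, i₁, Q₁, j₁, U₁, hU₁, hU₁'⟩ := exists_field_of_isEven.{v} hslow heven
    obtain ⟨Ω₂, i₂, Q₂, j₂, U₂, hU₂, hU₂'⟩ := exists_field_of_isEven.{v}
      (hslow.addAtoms k) (heven.addAtoms k)
    have hadd : ∀ m, ‖g m‖ ^ 2 * (addAtoms (divSymbol μX g) k {m}).toReal = (μX {m}).toReal := by
      intro m
      by_cases hm : g m = 0
      · simp [hm, hs.eq_zero hm]
      · have h1 : k ≠ m := fun h => hm (h ▸ hk)
        have h2 : -k ≠ m := fun h => hm (h ▸ hk')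
        rw [addAtoms_singleton, if_neg h1, if_neg h2, add_zero, add_zero,
          hs.norm_sq_mul_divSymbol]
    have heq := huniq.unique
      ⟨Ω₁, i₁, Q₁, j₁, U₁,
        isSolution_of_spectral hX hμX hU₁ hU₁' hs.norm_sq_mul_divSymbol, hU₁'⟩
      ⟨Ω₂, i₂, Q₂, j₂, U₂, isSolution_of_spectral hX hμX hU₂ hU₂' hadd, hU₂'⟩
    have hk0 : divSymbol μX g {k} = 0 := by
      rw [divSymbol_singleton, if_pos hk]
    -- Comparing masses at `k`: the quotient measure has none, whereas the modified one has at least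
    -- `1`.
    have h1 := addAtoms_singleton (divSymbol μX g) k k
    rw [← heq, hk0, if_pos rfl, zero_add] at h1
    exact one_ne_zero (add_eq_zero.1 h1.symm).1
  · intro hg
    obtain ⟨Ω₁, i₁, Q₁, j₁, U₁, hU₁, hU₁'⟩ := exists_field_of_isEven.{v} hslow heven
    refine ⟨divSymbol μX g, ⟨Ω₁, i₁, Q₁, j₁, U₁,
      isSolution_of_spectral hX hμX hU₁ hU₁' hs.norm_sq_mul_divSymbol, hU₁'⟩, ?_⟩
    rintro μ ⟨Ω₂, i₂, Q₂, j₂, U₂, hU₂, hU₂'⟩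
    -- The lattice is countable and all atoms are finite, so it suffices to compare real masses,
    -- where `|g k|² ≠ 0` can be cancelled.
    refine Measure.ext_of_singleton fun k => ?_
    refine (ENNReal.toReal_eq_toReal_iff' (hU₂'.1.singleton_ne_top k)
      (hslow.singleton_ne_top k)).1 ?_
    have h := (hU₂.spectral_eq hμX hU₂' k).trans (hs.norm_sq_mul_divSymbol k).symm
    exact mul_left_cancel₀ (pow_pos (hg k) 2).ne' h
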